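/- Let $\ell\ge 0$ be an integer, let $0<q<1$ and let $\lambda=(\lambda_1,\dots,\lambda_{\ell+1})\in\mathbb{R}^{\ell+1}$. For an integer $n\ge 0$ put $(n)_q!=(1-q)(1-q^2)\cdots(1-q^n)$, with $(0)_q!=1$. For $\underline p=(p_1,\dots,p_{\ell+1})\in\mathbb{Z}^{\ell+1}$ let $\mathcal P(\underline p)$ be the finite set of Gelfand–Zetlin patterns with top row $\underline p$, that is, of arrays of integers $(p_{k,i})_{1\le i\le k\le \ell+1}$ with $p_{\ell+1,i}=p_i$ for $1\le i\le \ell+1$ and $p_{k+1,i}\le p_{k,i}\le p_{k+1,i+1}$ for $1\le i\le k\le \ell$. Define $\Psi_\lambda:\mathbb{Z}^{\ell+1}\to\mathbb{R}$ by $$ \Psi_\lambda(\underline p)=\sum_{(p_{k,i})\in\mathcal P(\underline p)}\ \prod_{k=1}^{\ell+1} q^{\lambda_k\left(\sum_{i=1}^{k}p_{k,i}-\sum_{i=1}^{k-1}p_{k-1,i}\right)}\cdot \frac{\prod_{k=2}^{\ell}\prod_{i=1}^{k-1}(p_{k,i+1}-p_{k,i})_q!}{\prod_{k=1}^{\ell}\prod_{i=1}^{k}(p_{k,i}-p_{k+1,i})_q!\,(p_{k+1,i+1}-p_{k,i})_q!}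 $$ if $p_1\le p_2\le\dots\le p_{\ell+1}$, and $\Psi_\lambda(\underline p)=0$ otherwise. For $1\le r\le \ell+1$ let $\mathcal H_r$ be the lattice $q$-deformed $\mathfrak{gl}_{\ell+1}$-Toda Hamiltonian acting on functions on $\mathbb{Z}^{\ell+1}$, $$ \mathcal H_r=\sum_{I=\{i_1<\dots<i_r\}\subset\{1,\dots,\ell+1\}} X_{i_1}^{1-\delta_{i_1,1}}X_{i_2}^{1-\delta_{i_2-i_1,1}}\cdots X_{i_r}^{1-\delta_{i_r-i_{r-1},1}}\;T_{i_1}\cdots T_{i_r}, $$ where $\delta$ is the Kronecker delta, $X_1=1$, $X_i$ for $2\le i\le \ell+1$ is multiplication by $X_i(\underline p)=1-q^{p_i-p_{i-1}+1}$, and $(T_if)(\underline p)=f(p_1,\dots,p_{i-1},p_i+1,p_{i+1},\dots,p_{\ell+1})$. Then $\Psi_\lambda$ is a common eigenfunction of $\mathcal H_1,\dots,\mathcal H_{\ell+1}$: it is not identically zero, and for every $r=1,\dots,\ell+1$ and every $\underline p\in\mathbb{Z}^{\ell+1}$ $$ (\mathcal H_r\Psi_\lambda)(\underline p)=\Big(\sum_{I\subset\{1,\dots,\ell+1\},\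 |I|=r}\ \prod_{i\in I}q^{\lambda_i}\Big)\,\Psi_\lambda(\underline p). $$ -/

import Mathlib

namespace QToda

/-- The `q`-factorial `(n)_q! = (1 - q)(1 - q^2)...(1 - q^n)`, for an integer `n ≥ 0`.
It is only ever evaluated below at nonnegative integers. -/
noncomputable def qFactorial (q : ℝ) (n : ℤ) : ℝ :=
  ∏ j ∈ Finset.range n.toNat, (1 - q ^ (j + 1))

/-! ### The lattice `q`-deformed `gl_{ℓ+1}`-Toda Hamiltonians

Points of the lattice `ℤ^{ℓ+1}` are functions `p : Fin (ℓ + 1) → ℤ`; the coordinate with index `i`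
(counted from `0`) is the coordinate number `i + 1` in the usual numbering. -/

/-- The factor `X_i(p)`: it is `1` for the first index, and `1 - q^{p_i - p_{i-1} + 1}` for
every other index `i`. -/
noncomputable def todaX {ℓ : ℕ} (q : ℝ) (p : Fin (ℓ + 1) → ℤ) (i : Fin (ℓ + 1)) : ℝ :=
  Fin.cases (motive := fun _ => ℝ) 1 (fun j => 1 - q ^ (p j.succ - p j.castSucc + 1)) i

/-- The shift `T_I = ∏_{i ∈ I} T_i`, where `T_i` increases the `i`-th coordinate by one. -/
def shift {ℓ : ℕ} (I : Finset (Fin (ℓ + 1))) (f : (Fin (ℓ + 1) → ℤ) → ℝ) :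
    (Fin (ℓ + 1) → ℤ) → ℝ :=
  fun p => f (fun k => p k + if k ∈ I then 1 else 0)

/-- The coefficient `∏_k X_{i_k}^{1 - δ_{i_k - i_{k-1}, 1}}` of `T_I` for
`I = {i_1 < i_2 < ...}`: the factor of `i ∈ I` is omitted exactly when `i - 1 ∈ I`
(that of the first index is `1` anyway). -/
noncomputable def todaCoeff {ℓ : ℕ} (q : ℝ) (I : Finset (Fin (ℓ + 1)))
    (p : Fin (ℓ + 1) → ℤ) : ℝ :=
  ∏ i ∈ I, if ∃ j ∈ I, (j : ℕ) + 1 = (i : ℕ) then 1 else todaX q p i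

/-- The `r`-th Hamiltonian `H_r = ∑_{|I| = r} (∏_k X_{i_k}^{1 - δ_{i_k - i_{k-1}, 1}}) T_I`. -/
noncomputable def todaHamiltonian {ℓ : ℕ} (q : ℝ) (r : ℕ) (f : (Fin (ℓ + 1) → ℤ) → ℝ) :
    (Fin (ℓ + 1) → ℤ) → ℝ :=
  fun p => ∑ I ∈ Finset.powersetCard r (Finset.univ : Finset (Fin (ℓ + 1))),
    todaCoeff q I p * shift I f p

/-! ### Gelfand-Zetlin patterns and the function `Ψ` -/

/-- Triangular arrays of integers: the row with index `k` (counted from `0`) has `k + 1`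
entries, and there are `ℓ + 1` rows. -/
abbrev TriangularArray (ℓ : ℕ) : Type := (k : Fin (ℓ + 1)) → Fin ((k : ℕ) + 1) → ℤ

/-- Gelfand-Zetlin patterns with top row `p`: triangular arrays with last row `p`
satisfying `P_{k+1,j} ≤ P_{k,j} ≤ P_{k+1,j+1}`. -/
def gzPatterns {ℓ : ℕ} (p : Fin (ℓ + 1) → ℤ) : Set (TriangularArray ℓ) :=
  {P | P (Fin.last ℓ) = p ∧
    ∀ (k : Fin ℓ) (j : Fin ((k : ℕ) + 1)),
      P k.succ j.castSucc ≤ P k.castSucc j ∧ P k.castSucc j ≤ P k.succ j.succ}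

theorem gzPatterns_finite {ℓ : ℕ} (p : Fin (ℓ + 1) → ℤ) : (gzPatterns p).Finite := by
  classical
  obtain ⟨a, ha⟩ := (Set.finite_range p).bddBelow
  obtain ⟨b, hb⟩ := (Set.finite_range p).bddAbove
  refine Set.Finite.subset
    (Set.finite_Icc (fun _ _ => a : TriangularArray ℓ) (fun _ _ => b)) ?_
  rintro P ⟨hP, hI⟩
  have key : ∀ (k : Fin (ℓ + 1)) (j : Fin ((k : ℕ) + 1)), a ≤ P k j ∧ P k j ≤ b := by
    intro k
    induction k using Fin.reverseInduction with
    | last =>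
      intro j
      rw [hP]
      exact ⟨ha ⟨j, rfl⟩, hb ⟨j, rfl⟩⟩
    | cast k ih =>
      intro j
      exact ⟨(ih j.castSucc).1.trans (hI k j).1, (hI k j).2.trans (ih j.succ).2⟩
  exact ⟨fun k j => (key k j).1, fun k j => (key k j).2⟩

/-- The sum of the row below the row `k` (below the one-entry row there is the empty row). -/
def prevRowSum {ℓ : ℕ} (P : TriangularArray ℓ) (k : Fin (ℓ + 1)) : ℤ :=
  Fin.cases (motive := fun _ => ℤ) 0 (fun j => ∑ i, P j.castSucc i) k

/-- The summand attached to a pattern `P`. The index `k` runs over the rows other than the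
top row in the two products of `q`-factorials, and over all rows in the first product. -/
noncomputable def gzWeight {ℓ : ℕ} (q : ℝ) (lam : Fin (ℓ + 1) → ℝ) (P : TriangularArray ℓ) : ℝ :=
  (∏ k : Fin (ℓ + 1), q ^ (lam k * (((∑ i, P k i) - prevRowSum P k : ℤ) : ℝ))) *
    ((∏ k : Fin ℓ, ∏ i : Fin (k : ℕ),
        qFactorial q (P k.castSucc i.succ - P k.castSucc i.castSucc)) /
      (∏ k : Fin ℓ, ∏ i : Fin ((k : ℕ) + 1),
        qFactorial q (P k.castSucc i - P k.succ i.castSucc) *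
          qFactorial q (P k.succ i.succ - P k.castSucc i)))

open Classical in
/-- The function `Ψ_λ` on `ℤ^{ℓ+1}`: the sum over Gelfand-Zetlin patterns with top row `p`
if `p_1 ≤ ... ≤ p_{ℓ+1}`, and zero otherwise. -/
noncomputable def qWhittaker {ℓ : ℕ} (q : ℝ) (lam : Fin (ℓ + 1) → ℝ)
    (p : Fin (ℓ + 1) → ℤ) : ℝ :=
  if Monotone p then ∑ P ∈ (gzPatterns_finite p).toFinset, gzWeight q lam P else 0

end QToda

/-! The proof is by induction on `ℓ`, with all Hamiltonians packed into the generating function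
`hamiltonianSeries`, i.e. `∑_r t^r H_r`. Splitting off the top row of a pattern writes `Ψ` as an
integral transform of the same function of one variable fewer: with `z = q^{λ_{ℓ+1}}`, the kernel is
`z^{|p| - |p'|}` times `interlacingKernel` times `gapFactorial` of `p'` (`qWhittaker_succ`).

The heart is `interlacingKernel_intertwining`: for monotone `p'`, the series acting in `p` on the
kernel equals `1 + t z` times the adjoint of the smaller series acting in `p'`. Summation by parts
moves that adjoint onto the smaller `Ψ`, so each row contributes one factor `1 + t q^{λ_i}`.
Comparing coefficients of `t^r` gives the elementary symmetric functions.

After division by a common factor, the intertwining relation compares the partition functions of two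
one-dimensional chains of Boolean sites, the upper one site longer than the lower. This is
`sum_upperWeight`, proved by adding sites one at a time. -/

namespace QToda

open Finset

/-! ### A transfer-matrix identity -/

/-- The weight of a pair of neighbouring sites on the upper row. -/
noncomputable def upperLocal (a b : ℝ) (x y : Bool) : ℝ :=
  (if y ∧ ¬ x then 1 - a * b else 1) * ((if x then 1 - a else 1) * (if y then 1 else 1 - b))

/-- The weight of a configuration on the upper row. -/
noncomputable def upperWeight {n : ℕ} (s : ℝ) (a b : Fin n → ℝ) (ε : Fin (n + 1) → Bool) : ℝ :=
  (∏ i, if ε i then s else 1) * ∏ i : Fin n, upperLocal (a i) (b i) (ε i.castSucc) (ε i.succ)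

/-- The weight of a configuration on the lower row. -/
noncomputable def lowerWeight {m : ℕ} (s : ℝ) (a b : Fin (m + 1) → ℝ)
    (ε : Fin (m + 1) → Bool) : ℝ :=
  (∏ i, if ε i then s else 1) * ((∏ i, if ε i then 1 - a i else 1 - b i) *
    ∏ j : Fin m, if ε j.castSucc ∧ ¬ ε j.succ then 1 - b j.castSucc * a j.succ else 1)

theorem sum_bool_fun_succ {n : ℕ} (f : (Fin (n + 1) → Bool) → ℝ) :
    ∑ ε, f ε = ∑ ε : Fin n → Bool, f (Fin.snoc ε false) + ∑ ε : Fin n → Bool, f (Fin.snoc ε true) := by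
  rw [← (Fin.snocEquiv (fun _ : Fin (n + 1) => Bool)).sum_comp, Fintype.sum_prod_type]
  simp [Fin.snocEquiv, add_comm]

theorem upperWeight_snoc {n : ℕ} (s : ℝ) (a b : Fin (n + 1) → ℝ) (ε : Fin (n + 1) → Bool)
    (c : Bool) :
    upperWeight s a b (Fin.snoc ε c) =
      upperWeight s (fun i => a i.castSucc) (fun i => b i.castSucc) ε *
        ((if c then s else 1) *
          upperLocal (a (Fin.last n)) (b (Fin.last n)) (ε (Fin.last n)) c) := by
  have h1 : (∏ i, if (Fin.snoc ε c : Fin (n + 2) → Bool) i then s else 1) =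
      (∏ i, if ε i then s else 1) * if c then s else 1 := by
    rw [Fin.prod_univ_castSucc]
    simp only [Fin.snoc_castSucc, Fin.snoc_last]
  have h2 := Fin.prod_univ_castSucc fun i : Fin (n + 1) =>
    upperLocal (a i) (b i) ((Fin.snoc ε c : Fin (n + 2) → Bool) i.castSucc)
      ((Fin.snoc ε c : Fin (n + 2) → Bool) i.succ)
  simp only [Fin.succ_castSucc, Fin.succ_last, Fin.snoc_castSucc, Fin.snoc_last] at h2
  simp only [upperWeight, h1, Fin.snoc_castSucc, h2]
  ring

theorem lowerWeight_snoc {m : ℕ} (s : ℝ) (a b : Fin (m + 2) → ℝ) (ε : Fin (m + 1) → Bool)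
    (c : Bool) :
    lowerWeight s a b (Fin.snoc ε c) =
      lowerWeight s (fun i => a i.castSucc) (fun i => b i.castSucc) ε *
        ((if c then s else 1) * ((if c then 1 - a (Fin.last _) else 1 - b (Fin.last _)) *
          if ε (Fin.last m) ∧ ¬ c then 1 - b (Fin.last m).castSucc * a (Fin.last _) else 1)) := by
  have h1 : (∏ i, if (Fin.snoc ε c : Fin (m + 2) → Bool) i then s else 1) =
      (∏ i, if ε i then s else 1) * if c then s else 1 := by
    rw [Fin.prod_univ_castSucc]
    simp only [Fin.snoc_castSucc, Fin.snoc_last]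
  have h2 : (∏ i, if (Fin.snoc ε c : Fin (m + 2) → Bool) i then 1 - a i else 1 - b i) =
      (∏ i : Fin (m + 1), if ε i then 1 - a i.castSucc else 1 - b i.castSucc) *
        if c then 1 - a (Fin.last _) else 1 - b (Fin.last _) := by
    rw [Fin.prod_univ_castSucc]
    simp only [Fin.snoc_castSucc, Fin.snoc_last]
  have h3 := Fin.prod_univ_castSucc fun j : Fin (m + 1) =>
    if (Fin.snoc ε c : Fin (m + 2) → Bool) j.castSucc ∧
      ¬ (Fin.snoc ε c : Fin (m + 2) → Bool) j.succ then 1 - b j.castSucc * a j.succ else 1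
  simp only [Fin.succ_castSucc, Fin.succ_last, Fin.snoc_castSucc, Fin.snoc_last] at h3
  simp only [lowerWeight, h1, h2, Fin.snoc_castSucc, h3]
  ring

/-- The total sums alone do not obey a closed recursion, because the weight of a new site depends on
its neighbour. Recording the state of the last site makes the induction close; adding the two
equations gives the factor `1 + s`. -/
theorem transfer_identity {m : ℕ} (s : ℝ) (a b : Fin (m + 1) → ℝ) :
    (∑ ε : Fin (m + 1) → Bool, upperWeight s a b (Fin.snoc ε false) =
      ∑ ε : Fin m → Bool, lowerWeight s a b (Fin.snoc ε false) +
        (1 - b (Fin.last m)) * ∑ ε : Fin m → Bool, lowerWeight s a b (Fin.snoc ε true)) ∧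
    (∑ ε : Fin (m + 1) → Bool, upperWeight s a b (Fin.snoc ε true) =
      s * (∑ ε : Fin m → Bool, lowerWeight s a b (Fin.snoc ε false) +
        ∑ ε : Fin m → Bool, lowerWeight s a b (Fin.snoc ε true)) +
        b (Fin.last m) * ∑ ε : Fin m → Bool, lowerWeight s a b (Fin.snoc ε true)) := by
  induction m with
  | zero =>
    simp only [sum_bool_fun_succ (n := 0), upperWeight_snoc]
    simp [upperWeight, lowerWeight, upperLocal, Fin.snoc]
    constructor <;> ring
  | succ m ih =>
    obtain ⟨h0, h1⟩ := ih (fun i => a i.castSucc) (fun i => b i.castSucc)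
    simp only [upperWeight_snoc s a b, lowerWeight_snoc s a b]
    -- The shortened upper chain is split by its last state and rewritten by induction; the next
    -- line splits the lower one. Only two unknown sums remain, and both claims are linear in them.
    simp only [sum_bool_fun_succ (n := m + 1), Fin.snoc_last, ← Finset.sum_mul, h0, h1]
    simp only [sum_bool_fun_succ (n := m), Fin.snoc_last, ← Finset.sum_mul, upperLocal]
    constructor <;> simp <;> ring

theorem sum_upperWeight {m : ℕ} (s : ℝ) (a b : Fin (m + 1) → ℝ) :
    ∑ ε, upperWeight s a b ε = (1 + s) * ∑ ε, lowerWeight s a b ε := by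
  obtain ⟨h0, h1⟩ := transfer_identity s a b
  rw [sum_bool_fun_succ, h0, h1, sum_bool_fun_succ]
  ring

/-! ### `q`-factorials and their reciprocals -/

theorem one_sub_pow_succ_pos {q : ℝ} (hq0 : 0 < q) (hq1 : q < 1) (j : ℕ) :
    0 < 1 - q ^ (j + 1) :=
  sub_pos.2 (pow_lt_one₀ hq0.le hq1 j.succ_ne_zero)

theorem qFactorial_pos {q : ℝ} (hq0 : 0 < q) (hq1 : q < 1) (n : ℤ) : 0 < qFactorial q n :=
  Finset.prod_pos fun j _ => one_sub_pow_succ_pos hq0 hq1 j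

theorem qFactorial_add_one (q : ℝ) {n : ℤ} (hn : 0 ≤ n) :
    qFactorial q (n + 1) = (1 - q ^ (n + 1)) * qFactorial q n := by
  lift n to ℕ using hn
  have h : ((n : ℤ) + 1).toNat = n + 1 := by omega
  have h' : q ^ ((n : ℤ) + 1) = q ^ (n + 1) := by exact_mod_cast zpow_natCast q (n + 1)
  rw [qFactorial, h, Finset.prod_range_succ, h', mul_comm]
  simp [qFactorial]

/-- The reciprocal of the `q`-factorial, which vanishes at negative integers. -/
noncomputable def qFactorialInv (q : ℝ) (n : ℤ) : ℝ :=
  if n < 0 then 0 else (qFactorial q n)⁻¹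

theorem qFactorialInv_of_nonneg (q : ℝ) {n : ℤ} (hn : 0 ≤ n) :
    qFactorialInv q n = (qFactorial q n)⁻¹ := if_neg hn.not_gt

theorem nonneg_of_qFactorialInv_ne_zero {q : ℝ} {n : ℤ} (h : qFactorialInv q n ≠ 0) : 0 ≤ n := by
  by_contra hn
  exact h (if_pos (not_le.1 hn))

/-- Extending the reciprocal by zero makes the recursion valid at every integer: at `n = 0` the
factor `1 - q ^ n` vanishes. The boundary of the interlacing region then needs no separate
treatment. -/
theorem qFactorialInv_sub_one {q : ℝ} (hq0 : 0 < q) (hq1 : q < 1) (n : ℤ) :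
    qFactorialInv q (n - 1) = (1 - q ^ n) * qFactorialInv q n := by
  rcases lt_trichotomy n 0 with h | rfl | h
  · simp [qFactorialInv, h, show n - 1 < 0 by omega]
  · simp [qFactorialInv]
  · obtain ⟨k, rfl⟩ : ∃ k, n = k + 1 := ⟨n - 1, by ring⟩
    have h1 := qFactorial_pos hq0 hq1 (k + 1)
    rw [add_sub_cancel_right, qFactorialInv_of_nonneg q (by omega),
      qFactorialInv_of_nonneg q h.le]
    rw [qFactorial_add_one q (show 0 ≤ k by omega)] at h1 ⊢
    have h2 := (qFactorial_pos hq0 hq1 k).ne'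
    have h3 := left_ne_zero_of_mul h1.ne'
    field_simp

/-! ### The interlacing kernel -/

/-- The kernel `1 / ∏ (p'_i - p_i)_q! (p_{i+1} - p'_i)_q!`, zero unless `p'` interlaces `p`. -/
noncomputable def interlacingKernel {n : ℕ} (q : ℝ) (p : Fin (n + 1) → ℤ) (p' : Fin n → ℤ) : ℝ :=
  ∏ i, qFactorialInv q (p' i - p i.castSucc) * qFactorialInv q (p i.succ - p' i)

/-- The product of the `q`-factorials of the consecutive differences. -/
noncomputable def gapFactorial {n : ℕ} (q : ℝ) (p : Fin (n + 1) → ℤ) : ℝ :=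
  ∏ i : Fin n, qFactorial q (p i.succ - p i.castSucc)

/-- The zero-one vector of a Boolean vector. -/
def indicator {n : ℕ} (ε : Fin n → Bool) : Fin n → ℤ := fun i => if ε i then 1 else 0

/-- The coefficient of the Hamiltonians as a product over neighbouring sites. -/
noncomputable def shiftCoeff {n : ℕ} (q : ℝ) (ε : Fin (n + 1) → Bool) (p : Fin (n + 1) → ℤ) : ℝ :=
  ∏ i : Fin n, if ε i.succ ∧ ¬ ε i.castSucc then 1 - q ^ (p i.succ - p i.castSucc + 1) else 1

theorem le_of_interlacingKernel_ne_zero {n : ℕ} {q : ℝ} {p : Fin (n + 1) → ℤ} {p' : Fin n → ℤ}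
    (h : interlacingKernel q p p' ≠ 0) (i : Fin n) : p i.castSucc ≤ p' i ∧ p' i ≤ p i.succ := by
  have h' := Finset.prod_ne_zero_iff.1 h i (Finset.mem_univ i)
  exact ⟨sub_nonneg.1 (nonneg_of_qFactorialInv_ne_zero (left_ne_zero_of_mul h')),
    sub_nonneg.1 (nonneg_of_qFactorialInv_ne_zero (right_ne_zero_of_mul h'))⟩

/-- If only the right site of a pair is occupied, its gap shrinks by one and the coefficient
restores the lost factor; if only the left one is, the gap grows and the new factor remains.
Monotonicity keeps the arguments in the range where `qFactorial` satisfies its recursion. -/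
theorem gapFactorial_mul_shiftCoeff {m : ℕ} (q : ℝ) (p' : Fin (m + 1) → ℤ) (hp' : Monotone p')
    (ε : Fin (m + 1) → Bool) (hε : Monotone (p' - indicator ε)) :
    gapFactorial q (p' - indicator ε) * shiftCoeff q ε (p' - indicator ε) =
      gapFactorial q p' * ∏ j : Fin m, if ε j.castSucc ∧ ¬ ε j.succ then
        1 - q ^ (p' j.succ - p' j.castSucc + 1) else 1 := by
  unfold gapFactorial shiftCoeff
  rw [← Finset.prod_mul_distrib, ← Finset.prod_mul_distrib]
  refine Finset.prod_congr rfl fun j _ => ?_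
  have h1 : 0 ≤ p' j.succ - p' j.castSucc := sub_nonneg.2 (hp' j.castSucc_lt_succ.le)
  have h2 := hε j.castSucc_lt_succ.le
  simp only [Pi.sub_apply, indicator] at h2 ⊢
  generalize p' j.succ = x at *
  generalize p' j.castSucc = y at *
  cases hs : ε j.succ <;> cases hc : ε j.castSucc <;> simp [hs, hc] at h2 ⊢
  · rw [show x - (y - 1) = x - y + 1 by ring, qFactorial_add_one q h1, mul_comm]
  · have := qFactorial_add_one q (show 0 ≤ x - 1 - y by omega)
    rw [show x - 1 - y + 1 = x - y by ring] at this ⊢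
    rw [this, mul_comm]

/-- The common factor of all the terms in the kernel identity. -/
noncomputable def kernelBase {n : ℕ} (q : ℝ) (p : Fin (n + 1) → ℤ) (p' : Fin n → ℤ) : ℝ :=
  ∏ i, qFactorialInv q (p' i - p i.castSucc) * qFactorialInv q (p i.succ - p' i + 1)

/-- The arguments in `kernelBase` are the largest that occur, so every shift either keeps an
argument or lowers it by one, at the cost of a factor `1 - a` or `1 - b`. The coefficient of the
Hamiltonian becomes `1 - a * b`. -/
theorem shiftCoeff_mul_interlacingKernel {n : ℕ} {q : ℝ} (hq0 : 0 < q) (hq1 : q < 1)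
    (p : Fin (n + 1) → ℤ) (p' : Fin n → ℤ) (ε : Fin (n + 1) → Bool) :
    shiftCoeff q ε p * interlacingKernel q (p + indicator ε) p' =
      kernelBase q p p' * ∏ i : Fin n, upperLocal (q ^ (p' i - p i.castSucc))
        (q ^ (p i.succ - p' i + 1)) (ε i.castSucc) (ε i.succ) := by
  unfold shiftCoeff interlacingKernel kernelBase
  rw [← Finset.prod_mul_distrib, ← Finset.prod_mul_distrib]
  refine Finset.prod_congr rfl fun i _ => ?_
  have ha := qFactorialInv_sub_one hq0 hq1 (p' i - p i.castSucc)
  have hb := qFactorialInv_sub_one hq0 hq1 (p i.succ - p' i + 1)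
  rw [add_sub_cancel_right] at hb
  rw [upperLocal, ← zpow_add₀ hq0.ne', show p' i - p i.castSucc + (p i.succ - p' i + 1) =
    p i.succ - p i.castSucc + 1 by ring]
  simp only [Pi.add_apply, indicator]
  cases hs : ε i.succ <;> cases hc : ε i.castSucc <;>
    simp [← sub_sub, add_sub_right_comm, ha, hb] <;> ring

theorem interlacingKernel_sub_indicator {n : ℕ} {q : ℝ} (hq0 : 0 < q) (hq1 : q < 1)
    (p : Fin (n + 1) → ℤ) (p' : Fin n → ℤ) (ε : Fin n → Bool) :
    interlacingKernel q p (p' - indicator ε) = kernelBase q p p' *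
      ∏ i, if ε i then 1 - q ^ (p' i - p i.castSucc) else 1 - q ^ (p i.succ - p' i + 1) := by
  unfold interlacingKernel kernelBase
  rw [← Finset.prod_mul_distrib]
  refine Finset.prod_congr rfl fun i _ => ?_
  have ha := qFactorialInv_sub_one hq0 hq1 (p' i - p i.castSucc)
  have hb := qFactorialInv_sub_one hq0 hq1 (p i.succ - p' i + 1)
  rw [add_sub_cancel_right] at hb
  simp only [Pi.sub_apply, indicator]
  cases ε i
  · simp [hb]; ring
  · simp only [if_true]
    rw [sub_right_comm, ha, show p i.succ - (p' i - 1) = p i.succ - p' i + 1 by ring]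
    ring

/-- The intertwining relation satisfied by the interlacing kernel. -/
theorem interlacingKernel_intertwining {m : ℕ} {q : ℝ} (hq0 : 0 < q) (hq1 : q < 1) (s : ℝ)
    (p : Fin (m + 2) → ℤ) (p' : Fin (m + 1) → ℤ) (hp' : Monotone p') :
    (∑ ε, (∏ i, if ε i then s else 1) *
        (shiftCoeff q ε p * interlacingKernel q (p + indicator ε) p')) * gapFactorial q p' =
      (1 + s) * ∑ ε, (∏ i, if ε i then s else 1) * (interlacingKernel q p (p' - indicator ε) *
        (gapFactorial q (p' - indicator ε) * shiftCoeff q ε (p' - indicator ε))) := by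
  have hR : ∀ ε : Fin (m + 1) → Bool,
      (∏ i, if ε i then s else 1) * (interlacingKernel q p (p' - indicator ε) *
        (gapFactorial q (p' - indicator ε) * shiftCoeff q ε (p' - indicator ε))) =
      kernelBase q p p' * gapFactorial q p' * lowerWeight s (fun i => q ^ (p' i - p i.castSucc))
        (fun i => q ^ (p i.succ - p' i + 1)) ε := by
    intro ε
    have key : interlacingKernel q p (p' - indicator ε) *
        (gapFactorial q (p' - indicator ε) * shiftCoeff q ε (p' - indicator ε)) =
        interlacingKernel q p (p' - indicator ε) * (gapFactorial q p' *
          ∏ j : Fin m, if ε j.castSucc ∧ ¬ ε j.succ then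
            1 - q ^ (p' j.succ - p' j.castSucc + 1) else 1) := by
      -- A nonzero kernel forces `p' - indicator ε` to interlace `p`, hence to be monotone;
      -- otherwise both sides vanish.
      by_cases h : interlacingKernel q p (p' - indicator ε) = 0
      · simp [h]
      · rw [gapFactorial_mul_shiftCoeff q p' hp' ε]
        refine Fin.monotone_iff_le_succ.2 fun i => ?_
        exact (le_of_interlacingKernel_ne_zero h i.castSucc).2.trans
          (le_of_interlacingKernel_ne_zero h i.succ).1
    rw [key, interlacingKernel_sub_indicator hq0 hq1, lowerWeight]
    -- The entry of `p` lying between two neighbours of `p'` splits their gap, which produces the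
    -- products `b j.castSucc * a j.succ` of `lowerWeight`.
    have : ∀ j : Fin m, q ^ (p' j.succ - p' j.castSucc + 1) =
        q ^ (p j.castSucc.succ - p' j.castSucc + 1) * q ^ (p' j.succ - p j.succ.castSucc) := by
      intro j
      rw [← zpow_add₀ hq0.ne', Fin.succ_castSucc]
      congr 1
      ring
    simp only [this]
    ring
  simp only [hR, shiftCoeff_mul_interlacingKernel hq0 hq1]
  rw [← Finset.mul_sum, mul_left_comm, ← sum_upperWeight, Finset.mul_sum, Finset.sum_mul]
  refine Finset.sum_congr rfl fun ε _ => ?_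
  rw [upperWeight]
  ring

/-! ### The recursion for `qWhittaker` -/

theorem gzPatterns_interlacing {ℓ : ℕ} {p : Fin (ℓ + 2) → ℤ} {P : TriangularArray (ℓ + 1)}
    (hP : P ∈ gzPatterns p) (i : Fin (ℓ + 1)) :
    p i.castSucc ≤ P (Fin.last ℓ).castSucc i ∧ P (Fin.last ℓ).castSucc i ≤ p i.succ := by
  obtain ⟨rfl, h⟩ := hP
  exact h (Fin.last ℓ) i

theorem monotone_of_mem_gzPatterns {ℓ : ℕ} {p : Fin (ℓ + 1) → ℤ} {P : TriangularArray ℓ}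
    (hP : P ∈ gzPatterns p) : Monotone p := by
  cases ℓ with
  | zero => exact Subsingleton.monotone (α := Fin 1) p
  | succ ℓ =>
    exact Fin.monotone_iff_le_succ.2 fun i =>
      (gzPatterns_interlacing hP i).1.trans (gzPatterns_interlacing hP i).2

/-- A top row that is not monotone admits no pattern, so the sum is empty there. -/
theorem qWhittaker_eq_sum {ℓ : ℕ} (q : ℝ) (lam : Fin (ℓ + 1) → ℝ) (p : Fin (ℓ + 1) → ℤ) :
    qWhittaker q lam p = ∑ P ∈ (gzPatterns_finite p).toFinset, gzWeight q lam P := by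
  unfold qWhittaker
  split_ifs with h
  · rfl
  · refine (Finset.sum_eq_zero fun P hP => absurd ?_ h).symm
    exact monotone_of_mem_gzPatterns ((gzPatterns_finite p).mem_toFinset.1 hP)

theorem qWhittaker_of_not_monotone {ℓ : ℕ} (q : ℝ) (lam : Fin (ℓ + 1) → ℝ)
    {p : Fin (ℓ + 1) → ℤ} (hp : ¬ Monotone p) : qWhittaker q lam p = 0 :=
  if_neg hp

/-- The array with one more row on top. -/
def addRow {ℓ : ℕ} (P : TriangularArray ℓ) (p : Fin (ℓ + 2) → ℤ) : TriangularArray (ℓ + 1) :=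
  Fin.snoc (α := fun k : Fin (ℓ + 2) => Fin ((k : ℕ) + 1) → ℤ) P p

/-- The array without its top row. -/
def dropRow {ℓ : ℕ} (P : TriangularArray (ℓ + 1)) : TriangularArray ℓ := fun k => P k.castSucc

theorem addRow_castSucc {ℓ : ℕ} (P : TriangularArray ℓ) (p : Fin (ℓ + 2) → ℤ) (k : Fin (ℓ + 1)) :
    addRow P p k.castSucc = P k :=
  Fin.snoc_castSucc (α := fun k : Fin (ℓ + 2) => Fin ((k : ℕ) + 1) → ℤ) p P k

theorem addRow_last {ℓ : ℕ} (P : TriangularArray ℓ) (p : Fin (ℓ + 2) → ℤ) :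
    addRow P p (Fin.last (ℓ + 1)) = p :=
  Fin.snoc_last (α := fun k : Fin (ℓ + 2) => Fin ((k : ℕ) + 1) → ℤ) p P

theorem dropRow_addRow {ℓ : ℕ} (P : TriangularArray ℓ) (p : Fin (ℓ + 2) → ℤ) :
    dropRow (addRow P p) = P :=
  funext fun k => addRow_castSucc P p k

theorem addRow_dropRow {ℓ : ℕ} {p : Fin (ℓ + 2) → ℤ} {P : TriangularArray (ℓ + 1)}
    (hP : P ∈ gzPatterns p) : addRow (dropRow P) p = P := by
  obtain ⟨rfl, -⟩ := hP
  funext k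
  induction k using Fin.lastCases with
  | last => exact addRow_last _ _
  | cast k => exact addRow_castSucc _ _ k

theorem dropRow_mem_gzPatterns {ℓ : ℕ} {p : Fin (ℓ + 2) → ℤ} {P : TriangularArray (ℓ + 1)}
    (hP : P ∈ gzPatterns p) : dropRow P ∈ gzPatterns (dropRow P (Fin.last ℓ)) :=
  ⟨rfl, fun k j => hP.2 k.castSucc j⟩

theorem addRow_mem_gzPatterns {ℓ : ℕ} {p : Fin (ℓ + 2) → ℤ} {p' : Fin (ℓ + 1) → ℤ}
    {P : TriangularArray ℓ} (hP : P ∈ gzPatterns p')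
    (h : ∀ i, p i.castSucc ≤ p' i ∧ p' i ≤ p i.succ) : addRow P p ∈ gzPatterns p := by
  obtain ⟨rfl, hP⟩ := hP
  refine ⟨addRow_last P p, fun k => ?_⟩
  induction k using Fin.lastCases with
  | last =>
    intro j
    have h1 := congrFun (addRow_castSucc P p (Fin.last ℓ)) j
    have h2 := congrFun (addRow_last P p)
    exact ⟨(h2 j.castSucc).trans_le ((h j).1.trans_eq h1.symm),
      h1.trans_le ((h j).2.trans_eq (h2 j.succ).symm)⟩
  | cast k =>
    intro j
    have h1 := congrFun (addRow_castSucc P p k.castSucc) j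
    have h2 := congrFun (addRow_castSucc P p k.succ)
    exact ⟨(h2 j.castSucc).trans_le ((hP k j).1.trans_eq h1.symm),
      h1.trans_le ((hP k j).2.trans_eq (h2 j.succ).symm)⟩

/-- Gap factorials occur only for rows below the top, so `p'` acquires one when `p` is placed above
it. -/
theorem gzWeight_succ {ℓ : ℕ} {q : ℝ} (hq0 : 0 < q) (lam : Fin (ℓ + 2) → ℝ)
    {p : Fin (ℓ + 2) → ℤ} {p' : Fin (ℓ + 1) → ℤ} {P : TriangularArray (ℓ + 1)}
    (hP : P ∈ gzPatterns p) (hp' : P (Fin.last ℓ).castSucc = p') :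
    gzWeight q lam P = (q ^ lam (Fin.last _)) ^ (∑ i, p i - ∑ i, p' i) *
      (interlacingKernel q p p' * gapFactorial q p') *
        gzWeight q (fun i => lam i.castSucc) (dropRow P) := by
  have hK : interlacingKernel q p p' = (∏ i : Fin (ℓ + 1),
      qFactorial q (p' i - p i.castSucc) * qFactorial q (p i.succ - p' i))⁻¹ := by
    rw [interlacingKernel, ← Finset.prod_inv_distrib]
    refine Finset.prod_congr rfl fun i _ => ?_
    have := gzPatterns_interlacing hP i
    rw [hp'] at this
    rw [qFactorialInv_of_nonneg q (sub_nonneg.2 this.1),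
      qFactorialInv_of_nonneg q (sub_nonneg.2 this.2), mul_inv]
  have h1 : (∏ k : Fin (ℓ + 2), q ^ (lam k * (((∑ i, P k i) - prevRowSum P k : ℤ) : ℝ))) =
      (∏ k : Fin (ℓ + 1), q ^ (lam k.castSucc *
        (((∑ i, dropRow P k i) - prevRowSum (dropRow P) k : ℤ) : ℝ))) *
        (q ^ lam (Fin.last _)) ^ (∑ i, p i - ∑ i, p' i) := by
    rw [Fin.prod_univ_castSucc]
    congr 1
    · refine Finset.prod_congr rfl fun k _ => ?_
      have : prevRowSum P k.castSucc = prevRowSum (dropRow P) k := by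
        induction k using Fin.cases with
        | zero => rfl
        | succ k => rfl
      rw [this]
      rfl
    · rw [Real.rpow_mul hq0.le, Real.rpow_intCast, ← hP.1, ← hp']
      rfl
  have h2 : (∏ k : Fin (ℓ + 1), ∏ i : Fin (k : ℕ),
        qFactorial q (P k.castSucc i.succ - P k.castSucc i.castSucc)) =
      (∏ k : Fin ℓ, ∏ i : Fin (k : ℕ), qFactorial q (dropRow P k.castSucc i.succ -
        dropRow P k.castSucc i.castSucc)) * gapFactorial q p' := by
    rw [Fin.prod_univ_castSucc, ← hp']
    rfl
  have h3 : (∏ k : Fin (ℓ + 1), ∏ i : Fin ((k : ℕ) + 1),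
        qFactorial q (P k.castSucc i - P k.succ i.castSucc) *
          qFactorial q (P k.succ i.succ - P k.castSucc i)) =
      (∏ k : Fin ℓ, ∏ i : Fin ((k : ℕ) + 1),
        qFactorial q (dropRow P k.castSucc i - dropRow P k.succ i.castSucc) *
          qFactorial q (dropRow P k.succ i.succ - dropRow P k.castSucc i)) *
      ∏ i : Fin (ℓ + 1), qFactorial q (p' i - p i.castSucc) * qFactorial q (p i.succ - p' i) := by
    rw [Fin.prod_univ_castSucc, ← hp', ← hP.1]
    rfl
  rw [gzWeight, h1, h2, h3, hK, gzWeight, div_eq_mul_inv, div_eq_mul_inv, mul_inv]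
  ring

theorem qWhittaker_succ_eq_sum {ℓ : ℕ} {q : ℝ} (hq0 : 0 < q) (lam : Fin (ℓ + 2) → ℝ)
    (p : Fin (ℓ + 2) → ℤ) :
    qWhittaker q lam p = ∑ p' ∈ Finset.Icc (fun i : Fin (ℓ + 1) => p i.castSucc) (fun i => p i.succ),
      (q ^ lam (Fin.last _)) ^ (∑ i, p i - ∑ i, p' i) *
        (interlacingKernel q p p' * gapFactorial q p') *
          qWhittaker q (fun i => lam i.castSucc) p' := by
  simp only [qWhittaker_eq_sum, Finset.mul_sum]
  rw [Finset.sum_sigma']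
  refine Finset.sum_bij' (fun P _ => ⟨dropRow P (Fin.last ℓ), dropRow P⟩)
    (fun x _ => addRow x.2 p) ?_ ?_ ?_ ?_ ?_
  · intro P hP
    rw [Set.Finite.mem_toFinset] at hP
    simp only [Finset.mem_sigma, Finset.mem_Icc, Set.Finite.mem_toFinset, Pi.le_def]
    exact ⟨⟨fun i => (gzPatterns_interlacing hP i).1, fun i => (gzPatterns_interlacing hP i).2⟩,
      dropRow_mem_gzPatterns hP⟩
  · rintro ⟨p', P⟩ h
    simp only [Finset.mem_sigma, Finset.mem_Icc, Set.Finite.mem_toFinset, Pi.le_def] at h ⊢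
    exact addRow_mem_gzPatterns h.2 fun i => ⟨h.1.1 i, h.1.2 i⟩
  · intro P hP
    exact addRow_dropRow ((gzPatterns_finite p).mem_toFinset.1 hP)
  · rintro ⟨p', P⟩ h
    simp only [Finset.mem_sigma, Set.Finite.mem_toFinset] at h
    obtain ⟨-, rfl, -⟩ := h
    simp only [dropRow_addRow]
  · intro P hP
    exact gzWeight_succ hq0 lam ((gzPatterns_finite p).mem_toFinset.1 hP) rfl

theorem support_interlacingKernel_mul_subset {n : ℕ} (q : ℝ) (p : Fin (n + 1) → ℤ) (g : (Fin n → ℤ) → ℝ) :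
    (Function.support fun p' => interlacingKernel q p p' * g p') ⊆
      Finset.Icc (fun i : Fin n => p i.castSucc) (fun i => p i.succ) := by
  intro p' h
  have h' := le_of_interlacingKernel_ne_zero (left_ne_zero_of_mul h)
  rw [Finset.coe_Icc]
  exact ⟨fun i => (h' i).1, fun i => (h' i).2⟩

/-- Since the kernel vanishes off the interlacing box, the sum can run over the whole lattice, where
`p'` may be translated freely. -/
theorem qWhittaker_succ {ℓ : ℕ} {q : ℝ} (hq0 : 0 < q) (lam : Fin (ℓ + 2) → ℝ)
    (p : Fin (ℓ + 2) → ℤ) :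
    qWhittaker q lam p = ∑ᶠ p', interlacingKernel q p p' *
      ((q ^ lam (Fin.last _)) ^ (∑ i, p i - ∑ i, p' i) * gapFactorial q p' *
          qWhittaker q (fun i => lam i.castSucc) p') := by
  rw [finsum_eq_sum_of_support_subset _ (support_interlacingKernel_mul_subset q p _),
    qWhittaker_succ_eq_sum hq0]
  exact Finset.sum_congr rfl fun p' _ => by ring

/-! ### The generating function of the Hamiltonians -/

/-- The generating function `∑_r t^r H_r` of the Hamiltonians. -/
noncomputable def hamiltonianSeries {n : ℕ} (q t : ℝ) (f : (Fin (n + 1) → ℤ) → ℝ)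
    (p : Fin (n + 1) → ℤ) : ℝ :=
  ∑ ε : Fin (n + 1) → Bool, (∏ i, if ε i then t else 1) * (shiftCoeff q ε p * f (p + indicator ε))

theorem zpow_sum_indicator {n : ℕ} {z : ℝ} (hz : z ≠ 0) (ε : Fin n → Bool) :
    z ^ (∑ i, indicator ε i) = ∏ i, if ε i then z else 1 := by
  have h (s : Finset (Fin n)) : z ^ (∑ i ∈ s, indicator ε i) = ∏ i ∈ s, if ε i then z else 1 := by
    induction s using Finset.induction_on with
    | empty => simp
    | insert a s ha ih =>
      rw [Finset.sum_insert ha, Finset.prod_insert ha, zpow_add₀ hz, ih]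
      cases h : ε a <;> simp [indicator, h]
  exact h _

theorem prod_ite_mul {n : ℕ} (s t : ℝ) (ε : Fin n → Bool) :
    (∏ i, if ε i then s * t else 1) = (∏ i, if ε i then s else 1) * ∏ i, if ε i then t else 1 := by
  rw [← Finset.prod_mul_distrib]
  exact Finset.prod_congr rfl fun i _ => by cases ε i <;> simp

theorem hamiltonianSeries_qWhittaker_succ {ℓ : ℕ} {q : ℝ} (hq0 : 0 < q) (hq1 : q < 1) (t : ℝ)
    (lam : Fin (ℓ + 2) → ℝ) (p : Fin (ℓ + 2) → ℤ) :
    hamiltonianSeries q t (qWhittaker q lam) p = (1 + t * q ^ lam (Fin.last _)) *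
      ∑ᶠ p', interlacingKernel q p p' *
        ((q ^ lam (Fin.last _)) ^ (∑ i, p i - ∑ i, p' i) * gapFactorial q p' *
          hamiltonianSeries q t (qWhittaker q fun i => lam i.castSucc) p') := by
  set z := q ^ lam (Fin.last (ℓ + 1))
  set ψ := qWhittaker q fun i : Fin (ℓ + 1) => lam i.castSucc
  have hz : z ≠ 0 := (Real.rpow_pos_of_pos hq0 _).ne'
  have fin (p : Fin (ℓ + 2) → ℤ) (g : (Fin (ℓ + 1) → ℤ) → ℝ) :
      (Function.support fun p' => interlacingKernel q p p' * g p').Finite :=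
    (Finset.finite_toSet _).subset (support_interlacingKernel_mul_subset q p g)
  have fin' (c : ℝ) {g : (Fin (ℓ + 1) → ℤ) → ℝ} (hg : (Function.support g).Finite) :
      (Function.support fun p' => c * g p').Finite :=
    hg.subset (Function.support_mul_subset_right (fun _ => c) g)
  calc hamiltonianSeries q t (qWhittaker q lam) p
      = ∑ᶠ p', z ^ (∑ i, p i - ∑ i, p' i) * ψ p' *
          ((∑ ε : Fin (ℓ + 2) → Bool, (∏ i, if ε i then t * z else 1) *
            (shiftCoeff q ε p * interlacingKernel q (p + indicator ε) p')) * gapFactorial q p') := by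
        simp only [hamiltonianSeries, qWhittaker_succ hq0, mul_finsum]
        rw [← finsum_sum_comm]
        · refine finsum_congr fun p' => ?_
          rw [Finset.sum_mul, Finset.mul_sum]
          refine Finset.sum_congr rfl fun ε _ => ?_
          -- Shifting `p` by `ε` multiplies the power of `z` by one `z` per occupied site, so the
          -- chain parameter is `s = t * z`.
          rw [prod_ite_mul, ← zpow_sum_indicator hz]
          simp only [Pi.add_apply, Finset.sum_add_distrib]
          rw [add_sub_right_comm, zpow_add₀ hz]
          ring
        · exact fun ε _ => fin' _ (fin' _ (fin _ _))
    _ = ∑ᶠ p', ∑ ε : Fin (ℓ + 1) → Bool, (1 + t * z) * (z ^ (∑ i, p i - ∑ i, p' i) * ψ p' *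
          ((∏ i, if ε i then t * z else 1) * (interlacingKernel q p (p' - indicator ε) *
            (gapFactorial q (p' - indicator ε) * shiftCoeff q ε (p' - indicator ε))))) := by
        refine finsum_congr fun p' => ?_
        rw [← Finset.mul_sum, ← Finset.mul_sum]
        -- The intertwining relation is needed only for monotone `p'`, since `ψ` vanishes elsewhere.
        by_cases hp' : Monotone p'
        · rw [interlacingKernel_intertwining hq0 hq1 _ _ _ hp']
          ring
        · simp [ψ, qWhittaker_of_not_monotone _ _ hp']
    _ = ∑ ε : Fin (ℓ + 1) → Bool, ∑ᶠ p', (1 + t * z) * (z ^ (∑ i, p i - ∑ i, p' i) * ψ p' *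
          ((∏ i, if ε i then t * z else 1) * (interlacingKernel q p (p' - indicator ε) *
            (gapFactorial q (p' - indicator ε) * shiftCoeff q ε (p' - indicator ε))))) := by
        refine finsum_sum_comm _ _ fun ε _ => ?_
        refine (((fin p fun _ => 1).preimage
          (f := fun p' => p' - indicator ε) (sub_left_injective.injOn)).subset ?_)
        intro p' h h0
        simp only [mul_one] at h0
        exact h (by simp [h0])
    _ = ∑ ε : Fin (ℓ + 1) → Bool, ∑ᶠ p', (1 + t * z) * (interlacingKernel q p p' *
          (z ^ (∑ i, p i - ∑ i, p' i) * gapFactorial q p' * ((∏ i, if ε i then t else 1) *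
            (shiftCoeff q ε p' * ψ (p' + indicator ε))))) := by
        refine Finset.sum_congr rfl fun ε _ => ?_
        -- Summation by parts: translating `p'` by `ε` moves the shift from the kernel to `ψ`, and
        -- the change in the power of `z` turns `t * z` back into `t`.
        rw [← finsum_comp_equiv (Equiv.addRight (indicator ε))]
        refine finsum_congr fun p' => ?_
        simp only [Equiv.coe_addRight, add_sub_cancel_right, Pi.add_apply, Finset.sum_add_distrib]
        rw [prod_ite_mul, ← zpow_sum_indicator hz, ← sub_sub, zpow_sub₀ hz _ (∑ i, indicator ε i)]
        have := zpow_ne_zero (∑ i, indicator ε i) hz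
        field_simp
    _ = _ := by
        rw [← finsum_sum_comm, mul_finsum]
        · refine finsum_congr fun p' => ?_
          simp only [hamiltonianSeries, Finset.mul_sum]
        · exact fun ε _ => fin' _ (fin _ _)

/-! ### The one-variable case and the induction on `ℓ`. -/

theorem gzPatterns_zero (p : Fin 1 → ℤ) : gzPatterns p = {fun _ _ => p 0} := by
  ext P
  constructor
  · rintro ⟨rfl, -⟩
    funext k i
    obtain rfl := Subsingleton.elim (α := Fin 1) k (Fin.last 0)
    exact congrArg (P (Fin.last 0)) (Subsingleton.elim (α := Fin 1) i 0)
  · rintro rfl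
    exact ⟨funext fun i => congrArg p (Subsingleton.elim (α := Fin 1) 0 i), fun k => k.elim0⟩

theorem qWhittaker_zero {q : ℝ} (hq0 : 0 < q) (lam : Fin 1 → ℝ) (p : Fin 1 → ℤ) :
    qWhittaker q lam p = (q ^ lam 0) ^ p 0 := by
  rw [qWhittaker_eq_sum, Finset.sum_eq_single_of_mem (fun _ _ => p 0)]
  · rw [gzWeight, ← Real.rpow_intCast, ← Real.rpow_mul hq0.le]
    simp [prevRowSum]
  · rw [Set.Finite.mem_toFinset, gzPatterns_zero]
    rfl
  · intro P hP h
    rw [Set.Finite.mem_toFinset, gzPatterns_zero] at hP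
    exact absurd hP h

theorem hamiltonianSeries_qWhittaker {ℓ : ℕ} {q : ℝ} (hq0 : 0 < q) (hq1 : q < 1) (t : ℝ)
    (lam : Fin (ℓ + 1) → ℝ) (p : Fin (ℓ + 1) → ℤ) :
    hamiltonianSeries q t (qWhittaker q lam) p =
      (∏ i, (1 + t * q ^ lam i)) * qWhittaker q lam p := by
  induction ℓ with
  | zero =>
    have hz : q ^ lam 0 ≠ 0 := (Real.rpow_pos_of_pos hq0 _).ne'
    simp only [hamiltonianSeries, sum_bool_fun_succ, qWhittaker_zero hq0]
    simp [shiftCoeff, indicator, Fin.snoc, zpow_add₀ hz]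
    ring
  | succ ℓ ih =>
    rw [hamiltonianSeries_qWhittaker_succ hq0 hq1, Fin.prod_univ_castSucc, qWhittaker_succ hq0]
    simp only [ih]
    rw [mul_comm (∏ i : Fin (ℓ + 1), _), mul_assoc, mul_finsum _ (∏ i : Fin (ℓ + 1), _)]
    congr 1
    exact finsum_congr fun p' => by ring

/-! ### Extraction of coefficients -/

/-- Whether `X_i` appears depends only on the membership of `i - 1` and `i`, so the coefficient
factors over adjacent pairs; the first index drops out because its factor is `1`. -/
theorem todaCoeff_eq_shiftCoeff {ℓ : ℕ} (q : ℝ) (I : Finset (Fin (ℓ + 1))) (p : Fin (ℓ + 1) → ℤ) :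
    todaCoeff q I p = shiftCoeff q (fun i => decide (i ∈ I)) p := by
  have h : todaCoeff q I p = ∏ i, if i ∈ I then
      if ∃ j ∈ I, (j : ℕ) + 1 = (i : ℕ) then 1 else todaX q p i else 1 := by
    rw [Finset.prod_ite_mem, Finset.univ_inter, todaCoeff]
  have hex (i : Fin ℓ) : (∃ j ∈ I, (j : ℕ) + 1 = (i.succ : ℕ)) ↔ i.castSucc ∈ I := by
    constructor
    · rintro ⟨j, hj, h⟩
      rwa [show i.castSucc = j from Fin.ext (by simpa using h.symm)]
    · exact fun h => ⟨_, h, rfl⟩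
  rw [h, Fin.prod_univ_succ, shiftCoeff]
  have h0 : todaX q p 0 = 1 := rfl
  rw [h0, ite_self, ite_self, one_mul]
  refine Finset.prod_congr rfl fun i _ => ?_
  have hs : todaX q p i.succ = 1 - q ^ (p i.succ - p i.castSucc + 1) := rfl
  simp only [hex, hs, decide_eq_true_eq]
  split_ifs <;> simp_all

theorem hamiltonianSeries_eq_sum {ℓ : ℕ} (q t : ℝ) (f : (Fin (ℓ + 1) → ℤ) → ℝ)
    (p : Fin (ℓ + 1) → ℤ) :
    hamiltonianSeries q t f p = ∑ r ∈ Finset.range (ℓ + 2), todaHamiltonian q r f p * t ^ r := by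
  have e : hamiltonianSeries q t f p =
      ∑ I : Finset (Fin (ℓ + 1)), todaCoeff q I p * shift I f p * t ^ I.card := by
    refine Finset.sum_bij' (fun ε _ => Finset.univ.filter fun i => ε i = true)
      (fun I _ i => decide (i ∈ I)) (by simp) (by simp) (by simp) (by simp) ?_
    intro ε _
    rw [todaCoeff_eq_shiftCoeff, shift, Finset.prod_ite]
    simp only [Finset.prod_const, Finset.mem_filter, Finset.mem_univ, true_and, Bool.decide_eq_true,
      one_pow, mul_one]
    rw [mul_comm]
    rfl
  rw [e, ← Finset.powerset_univ, Finset.sum_powerset]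
  simp only [Finset.card_univ, Fintype.card_fin]
  refine Finset.sum_congr rfl fun r _ => ?_
  rw [todaHamiltonian, Finset.sum_mul]
  refine Finset.sum_congr rfl fun I hI => ?_
  rw [(Finset.mem_powersetCard.1 hI).2]

theorem prod_one_add_mul_eq_sum {n : ℕ} (x : Fin n → ℝ) (t : ℝ) :
    ∏ i, (1 + t * x i) = ∑ r ∈ Finset.range (n + 1),
      (∑ I ∈ Finset.powersetCard r (Finset.univ : Finset (Fin n)), ∏ i ∈ I, x i) * t ^ r := by
  rw [Finset.prod_one_add, Finset.sum_powerset]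
  simp only [Finset.card_univ, Fintype.card_fin]
  refine Finset.sum_congr rfl fun r _ => ?_
  rw [Finset.sum_mul]
  refine Finset.sum_congr rfl fun I hI => ?_
  rw [Finset.prod_mul_distrib, Finset.prod_const, (Finset.mem_powersetCard.1 hI).2, mul_comm]

theorem eq_of_sum_mul_pow_eq {n : ℕ} {a b : ℕ → ℝ}
    (h : ∀ t : ℝ, ∑ r ∈ Finset.range n, a r * t ^ r = ∑ r ∈ Finset.range n, b r * t ^ r)
    {r : ℕ} (hr : r < n) : a r = b r := by
  have hp : (∑ r ∈ Finset.range n, Polynomial.C (a r) * Polynomial.X ^ r) =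
      ∑ r ∈ Finset.range n, Polynomial.C (b r) * Polynomial.X ^ r :=
    Polynomial.funext fun t => by simpa [Polynomial.eval_finsetSum] using h t
  simpa [Polynomial.finsetSum_coeff, Polynomial.coeff_C_mul, Polynomial.coeff_X_pow, hr] using
    congrArg (fun f => Polynomial.coeff f r) hp

/-! ### Positivity and non-vanishing. -/

/-- No interlacing is required: at negative arguments `qFactorial` is an empty product, equal to
`1`. -/
theorem gzWeight_pos {ℓ : ℕ} {q : ℝ} (hq0 : 0 < q) (hq1 : q < 1) (lam : Fin (ℓ + 1) → ℝ)
    (P : TriangularArray ℓ) : 0 < gzWeight q lam P := by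
  refine mul_pos (Finset.prod_pos fun k _ => Real.rpow_pos_of_pos hq0 _) (div_pos ?_ ?_)
  · exact Finset.prod_pos fun k _ => Finset.prod_pos fun i _ => qFactorial_pos hq0 hq1 _
  · exact Finset.prod_pos fun k _ => Finset.prod_pos fun i _ =>
      mul_pos (qFactorial_pos hq0 hq1 _) (qFactorial_pos hq0 hq1 _)

theorem qWhittaker_const_pos {ℓ : ℕ} {q : ℝ} (hq0 : 0 < q) (hq1 : q < 1) (lam : Fin (ℓ + 1) → ℝ) :
    0 < qWhittaker q lam fun _ => 0 := by
  rw [qWhittaker_eq_sum]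
  refine Finset.sum_pos (fun P _ => gzWeight_pos hq0 hq1 lam P) ⟨fun _ _ => 0, ?_⟩
  rw [Set.Finite.mem_toFinset]
  exact ⟨rfl, fun _ _ => ⟨le_rfl, le_rfl⟩⟩

end QToda

/-- For `0 < q < 1` and real `λ_1, ..., λ_{ℓ+1}`, the function `Ψ_λ` is a common eigenfunction of
all the lattice Hamiltonians `H_r`, `1 ≤ r ≤ ℓ + 1`, and the eigenvalue of `H_r` is the `r`-th
elementary symmetric function of the numbers `q^{λ_i}`. -/
theorem mainTheorem1 (ℓ : ℕ) (q : ℝ) (hq0 : 0 < q) (hq1 : q < 1) (lam : Fin (ℓ + 1) → ℝ) :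
    (∃ p : Fin (ℓ + 1) → ℤ, QToda.qWhittaker q lam p ≠ 0) ∧
    ∀ r : ℕ, 1 ≤ r → r ≤ ℓ + 1 → ∀ p : Fin (ℓ + 1) → ℤ,
      QToda.todaHamiltonian q r (QToda.qWhittaker q lam) p =
        (∑ I ∈ Finset.powersetCard r (Finset.univ : Finset (Fin (ℓ + 1))),
          ∏ i ∈ I, q ^ lam i) * QToda.qWhittaker q lam p := by
  refine ⟨⟨_, (QToda.qWhittaker_const_pos hq0 hq1 lam).ne'⟩, fun r _ hr p => ?_⟩
  refine QToda.eq_of_sum_mul_pow_eq (n := ℓ + 2)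
    (a := fun r => QToda.todaHamiltonian q r (QToda.qWhittaker q lam) p)
    (b := fun r => (∑ I ∈ Finset.powersetCard r (Finset.univ : Finset (Fin (ℓ + 1))),
      ∏ i ∈ I, q ^ lam i) * QToda.qWhittaker q lam p) (fun t => ?_) (by omega)
  rw [← QToda.hamiltonianSeries_eq_sum, QToda.hamiltonianSeries_qWhittaker hq0 hq1,
    QToda.prod_one_add_mul_eq_sum, Finset.sum_mul]
  exact Finset.sum_congr rfl fun r _ => by ring
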